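/- Let $H \neq \{0\}$ be a separable complex Hilbert space (of finite or infinite dimension), let $\mathcal{B}(H)$ be the space of bounded linear operators on $H$ with the operator-norm topology, and for $T \in \mathcal{B}(H)$ let $\sigma_p(T) = \{\lambda \in \mathbb{C} : \ker(T - \lambda\, \mathrm{id}_H) \neq \{0\}\}$ be its point spectrum. Then the set $$\{T \in \mathcal{B}(H) : \sigma_p(T) = \emptyset\}$$ is nowhere dense in $\mathcal{B}(H)$, i.e. its closure has empty interior. In particular, the set $$\{T \in \mathcal{B}(H) : \sigma_p(T) \neq \emptyset\}$$ is co-meager in $\mathcal{B}(H)$, i.e. it contains a dense $G_\delta$ set. -/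

import Mathlib

/-- The point spectrum of a bounded operator: all `z : ℂ` with `ker (T - z • id) ≠ {0}`. -/
def pointSpectrum {H : Type*} [NormedAddCommGroup H] [InnerProductSpace ℂ H]
    (T : H →L[ℂ] H) : Set ℂ :=
  {z : ℂ | LinearMap.ker (T - z • ContinuousLinearMap.id ℂ H : H →L[ℂ] H).toLinearMap ≠ ⊥}

open Filter Topology BoundedContinuousFunction

/-! In finite dimension every operator has an eigenvalue. Otherwise it suffices that operators `C`
for which some `C - z` has a non-surjective right inverse `R` are dense: `(C - z) R` stays
invertible under small perturbation, and were `C - z` injective, `R` would be onto.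

To perturb `T` into such an operator, find `z` such that `S = T - z` is arbitrarily small on unit
vectors orthogonal to any given finite-dimensional subspace. This is an approximate eigenvalue of
`T` acting on weakly null sequences modulo norm-null ones, where finite-dimensional components
vanish. Then `S` is small on the range of a non-surjective isometry `j`, and `S j j*` can be
replaced by `δ j*` at small cost. -/

/-- Every bounded operator on a nonzero complex Banach space has an approximate eigenvalue. -/
theorem ContinuousLinearMap.exists_approximate_eigenvalue {E : Type*} [NormedAddCommGroup E]
    [NormedSpace ℂ E] [CompleteSpace E] [Nontrivial E] (A : E →L[ℂ] E) :
    ∃ z : ℂ, ∀ ε > 0, ∃ x : E, ‖A x - z • x‖ < ε * ‖x‖ := by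
  have hne : spectrum ℂ A ≠ Set.univ := fun h =>
    NormedSpace.unbounded_univ ℂ ℂ (h ▸ spectrum.isBounded A)
  obtain ⟨z, hz⟩ := nonempty_frontier_iff.2 ⟨spectrum.nonempty A, hne⟩
  refine ⟨z, fun ε hε => ?_⟩
  by_contra! hb
  have hzs : z ∈ spectrum ℂ A := (spectrum.isClosed A).frontier_subset hz
  rw [frontier_eq_closure_inter_closure] at hz
  -- If `A - z` were bounded below by `ε`, then `A - w` would be by `ε / 2`, so its inverse would
  -- have norm at most `2 / ε` and `z` would lie in the resolvent set.
  obtain ⟨w, hw, hwz⟩ := Metric.mem_closure_iff.1 hz.2 (ε / 4) (by positivity)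
  have hw' : IsUnit (algebraMap ℂ (E →L[ℂ] E) w - A) := by
    simpa [spectrum.mem_iff] using hw
  obtain ⟨u, hu⟩ := hw'
  rw [dist_eq_norm] at hwz
  have hbound : ∀ x, ε / 2 * ‖x‖ ≤ ‖(u : E →L[ℂ] E) x‖ := by
    intro x
    have h1 : A x - z • x = -((u : E →L[ℂ] E) x) - (z - w) • x := by
      rw [hu]; simp [Algebra.algebraMap_eq_smul_one, sub_smul]
    have h2 := hb x
    rw [h1] at h2
    have h3 := norm_sub_le (-((u : E →L[ℂ] E) x)) ((z - w) • x)
    rw [norm_neg, norm_smul] at h3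
    have h4 := mul_le_mul_of_nonneg_right hwz.le (norm_nonneg x)
    nlinarith [mul_nonneg hε.le (norm_nonneg x)]
  have hinv : ‖((u⁻¹ : (E →L[ℂ] E)ˣ) : E →L[ℂ] E)‖ ≤ 2 / ε := by
    refine ContinuousLinearMap.opNorm_le_bound _ (by positivity) fun y => ?_
    have h := hbound (((u⁻¹ : (E →L[ℂ] E)ˣ) : E →L[ℂ] E) y)
    rw [← mul_apply_eq_comp, Units.mul_inv, one_apply_eq_self] at h
    rw [div_mul_eq_mul_div, le_div_iff₀ hε]
    linarith
  have hpos : 0 < ‖((u⁻¹ : (E →L[ℂ] E)ˣ) : E →L[ℂ] E)‖ := norm_pos_iff.2 (Units.ne_zero _)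
  apply hzs
  refine (u.ofNearby (algebraMap ℂ (E →L[ℂ] E) z - A) ?_).isUnit
  have h5 : (algebraMap ℂ (E →L[ℂ] E) z - A) - u = algebraMap ℂ _ (z - w) := by
    rw [hu, map_sub]; abel
  rw [h5, norm_algebraMap']
  refine hwz.trans ((?_ : ε / 4 < ε / 2).trans_le ?_)
  · linarith
  · rw [le_inv_comm₀ (by positivity) hpos]
    simpa using hinv

/-! ### Weakly null sequences modulo norm-null ones -/

/-- Bounded sequences tending to zero. -/
def nullSequences (E : Type*) [NormedAddCommGroup E] [NormedSpace ℂ E] :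
    Submodule ℂ (ℕ →ᵇ E) where
  carrier := {x | Tendsto x atTop (𝓝 0)}
  zero_mem' := tendsto_const_nhds
  add_mem' {x y} hx hy := by
    have h := Tendsto.add hx hy
    rw [add_zero] at h
    exact h
  smul_mem' c x hx := by simpa using Tendsto.const_smul hx c

theorem mem_nullSequences {E : Type*} [NormedAddCommGroup E] [NormedSpace ℂ E] {x : ℕ →ᵇ E} :
    x ∈ nullSequences E ↔ Tendsto x atTop (𝓝 0) := Iff.rfl

theorem isClosed_nullSequences (E : Type*) [NormedAddCommGroup E] [NormedSpace ℂ E] :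
    IsClosed (nullSequences E : Set (ℕ →ᵇ E)) := by
  rw [← closure_subset_iff_isClosed]
  intro x hx
  refine Metric.tendsto_nhds.2 fun ε hε => ?_
  obtain ⟨y, hy, hxy⟩ := Metric.mem_closure_iff.1 hx (ε / 2) (half_pos hε)
  filter_upwards [Metric.tendsto_nhds.1 (mem_nullSequences.1 hy) (ε / 2) (half_pos hε)] with n hn
  have h1 := (x.dist_coe_le_dist (g := y) n)
  have h2 := dist_triangle (x n) (y n) 0
  linarith

section Hilbert

variable {H : Type*} [NormedAddCommGroup H] [InnerProductSpace ℂ H]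

/-- Bounded sequences in an inner product space tending weakly to zero. -/
noncomputable def weaklyNullSequences (H : Type*) [NormedAddCommGroup H] [InnerProductSpace ℂ H] :
    Submodule ℂ (ℕ →ᵇ H) :=
  ⨅ y : H, (nullSequences ℂ).comap ((innerSL ℂ y).compLeftContinuousBounded ℕ).toLinearMap

theorem mem_weaklyNullSequences {x : ℕ →ᵇ H} :
    x ∈ weaklyNullSequences H ↔ ∀ y, Tendsto (fun n => inner ℂ y (x n)) atTop (𝓝 0) := by
  simp only [weaklyNullSequences, Submodule.mem_iInf, Submodule.mem_comap]
  rfl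

theorem isClosed_weaklyNullSequences : IsClosed (weaklyNullSequences H : Set (ℕ →ᵇ H)) := by
  simp only [weaklyNullSequences, Submodule.coe_iInf]
  exact isClosed_iInter fun y =>
    (isClosed_nullSequences ℂ).preimage ((innerSL ℂ y).compLeftContinuousBounded ℕ).continuous

/-- The norm-null sequences, as a subspace of the weakly null ones. -/
noncomputable abbrev nullInWeaklyNull (H : Type*) [NormedAddCommGroup H] [InnerProductSpace ℂ H] :
    Submodule ℂ (weaklyNullSequences H) :=
  (nullSequences H).comap (weaklyNullSequences H).subtype

instance isClosed_nullInWeaklyNull : IsClosed (nullInWeaklyNull H : Set (weaklyNullSequences H)) :=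
  (isClosed_nullSequences H).preimage continuous_subtype_val

instance completeSpace_weaklyNullSequences [CompleteSpace H] :
    CompleteSpace (weaklyNullSequences H) :=
  isClosed_weaklyNullSequences.completeSpace_coe

/-- Termwise action of an operator on weakly null sequences. -/
noncomputable def weaklyNullMap [CompleteSpace H] (T : H →L[ℂ] H) :
    weaklyNullSequences H →L[ℂ] weaklyNullSequences H :=
  ((T.compLeftContinuousBounded ℕ).comp (weaklyNullSequences H).subtypeL).codRestrict _ fun x => by
    refine mem_weaklyNullSequences.2 fun y => ?_
    simpa [ContinuousLinearMap.adjoint_inner_left] using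
      mem_weaklyNullSequences.1 x.2 (T.adjoint y)

theorem weaklyNullMap_apply [CompleteSpace H] (T : H →L[ℂ] H) (x : weaklyNullSequences H) (n : ℕ) :
    (weaklyNullMap T x : ℕ →ᵇ H) n = T ((x : ℕ →ᵇ H) n) := rfl

/-- The action of an operator on weakly null sequences modulo norm-null ones. -/
noncomputable def weaklyNullQuotientMap [CompleteSpace H] (T : H →L[ℂ] H) :
    (weaklyNullSequences H ⧸ nullInWeaklyNull H) →L[ℂ]
      (weaklyNullSequences H ⧸ nullInWeaklyNull H) :=
  (nullInWeaklyNull H).liftQL ((nullInWeaklyNull H).mkQL.comp (weaklyNullMap T)) fun x hx => by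
    have hx' : Tendsto (x : ℕ →ᵇ H) atTop (𝓝 0) := hx
    refine (Submodule.Quotient.mk_eq_zero _).2 ?_
    have := (T.continuous.tendsto 0).comp hx'
    rw [map_zero] at this
    exact this

/-- Modulo norm-null sequences, the norm of a sequence is controlled by its tail. -/
theorem norm_mk_le_of_eventually {x : weaklyNullSequences H} {r : ℝ} (hr : 0 ≤ r)
    (h : ∀ᶠ n in atTop, ‖(x : ℕ →ᵇ H) n‖ ≤ r) :
    ‖(Submodule.Quotient.mk x : weaklyNullSequences H ⧸ nullInWeaklyNull H)‖ ≤ r := by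
  obtain ⟨N, hN⟩ := eventually_atTop.1 h
  let t : ℕ →ᵇ H := BoundedContinuousFunction.ofNormedAddCommGroupDiscrete
    (fun n => if N ≤ n then (x : ℕ →ᵇ H) n else 0) r fun n => by
      by_cases hn : N ≤ n
      · simpa [hn] using hN n hn
      · simpa [hn] using hr
  have ht : ∀ᶠ n in atTop, (x : ℕ →ᵇ H) n = t n :=
    (eventually_ge_atTop N).mono fun n hn => by simp [t, hn]
  have htw : t ∈ weaklyNullSequences H := mem_weaklyNullSequences.2 fun y =>
    (mem_weaklyNullSequences.1 x.2 y).congr' (ht.mono fun n hn => by simp only [hn])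
  have hxt : (Submodule.Quotient.mk x : weaklyNullSequences H ⧸ nullInWeaklyNull H) =
      Submodule.Quotient.mk ⟨t, htw⟩ := by
    refine (Submodule.Quotient.eq _).2 ?_
    refine (tendsto_const_nhds (x := (0 : H))).congr' (ht.mono fun n hn => ?_)
    simp [hn]
  rw [hxt]
  refine (Submodule.Quotient.norm_mk_le _ _).trans ?_
  refine (BoundedContinuousFunction.norm_le hr).2 fun n => ?_
  by_cases hn : N ≤ n
  · simpa [t, hn] using hN n hn
  · simpa [t, hn] using hr

theorem exists_norm_eq_one_orthogonal (hH : ¬ FiniteDimensional ℂ H) (F : Submodule ℂ H)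
    [FiniteDimensional ℂ F] : ∃ x ∈ Fᗮ, ‖x‖ = 1 := by
  have hF : Fᗮ ≠ ⊥ := fun h => hH <| by
    have := Submodule.orthogonal_eq_bot_iff.1 h
    subst this
    exact Module.Finite.equiv (Submodule.topEquiv (R := ℂ) (M := H))
  obtain ⟨x, hx, hx0⟩ := Submodule.exists_mem_ne_zero_of_ne_bot hF
  exact ⟨((‖x‖⁻¹ : ℝ) : ℂ) • x, Submodule.smul_mem _ _ hx, by
    rw [norm_smul]; simp [hx0]⟩

/-- Greedy choice of an orthonormal sequence with rapidly decreasing images. -/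
theorem exists_orthonormal_seq_of_forall_finiteDimensional (S : H →L[ℂ] H)
    (h : ∀ ε > 0, ∀ F : Submodule ℂ H, FiniteDimensional ℂ F → ∃ x ∈ Fᗮ, ‖x‖ = 1 ∧ ‖S x‖ ≤ ε)
    {δ : ℝ} (hδ : 0 < δ) :
    ∃ e : ℕ → H, Orthonormal ℂ e ∧ ∀ n, ‖S (e n)‖ ≤ δ * (1 / 2) ^ n := by
  -- Each vector carries a natural label giving its decay rate; labels strictly increase, so the
  -- `n`-th is at least `n`.
  obtain ⟨f, hf, hr⟩ := exists_seq_of_forall_finset_exists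
    (fun p : H × ℕ => ‖p.1‖ = 1 ∧ ‖S p.1‖ ≤ δ * (1 / 2) ^ p.2)
    (fun p q => inner ℂ p.1 q.1 = 0 ∧ p.2 < q.2) fun s _ => by
      classical
      let k := s.sup Prod.snd + 1
      let F := Submodule.span ℂ ((s.image Prod.fst : Finset H) : Set H)
      obtain ⟨x, hxF, hx1, hx2⟩ := h (δ * (1 / 2) ^ k) (by positivity) F
        (FiniteDimensional.span_finset ℂ _)
      refine ⟨(x, k), ⟨hx1, hx2⟩, fun p hp => ⟨?_, ?_⟩⟩
      · exact Submodule.inner_right_of_mem_orthogonal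
          (Submodule.subset_span (by simpa using ⟨p.2, hp⟩)) hxF
      · exact Nat.lt_succ_of_le (Finset.le_sup (f := Prod.snd) hp)
  refine ⟨fun n => (f n).1, ⟨fun n => (hf n).1, fun m n hmn => ?_⟩, fun n => (hf n).2.trans ?_⟩
  · rcases hmn.lt_or_gt with hlt | hlt
    · exact (hr m n hlt).1
    · exact inner_eq_zero_symm.1 (hr n m hlt).1
  · have hmono : StrictMono fun n => (f n).2 := fun m n hmn => (hr m n hmn).2
    gcongr ?_ * ?_
    exact pow_le_pow_of_le_one (by norm_num) (by norm_num) (hmono.id_le n)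

/-- By Bessel's inequality an orthonormal sequence is weakly null, yet its norms are 1. -/
theorem nontrivial_weaklyNullQuotient (hH : ¬ FiniteDimensional ℂ H) :
    Nontrivial (weaklyNullSequences H ⧸ nullInWeaklyNull H) := by
  obtain ⟨e, he, -⟩ := exists_orthonormal_seq_of_forall_finiteDimensional (0 : H →L[ℂ] H)
    (fun ε hε F hF => by
      obtain ⟨x, hx, hx1⟩ := exists_norm_eq_one_orthogonal hH F
      exact ⟨x, hx, hx1, by simpa using hε.le⟩) one_pos
  let t : ℕ →ᵇ H :=
    BoundedContinuousFunction.ofNormedAddCommGroupDiscrete e 1 fun n => (he.1 n).le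
  have ht : t ∈ weaklyNullSequences H := mem_weaklyNullSequences.2 fun y => by
    have h1 := (he.inner_products_summable y).tendsto_atTop_zero
    rw [tendsto_zero_iff_norm_tendsto_zero]
    have h2 := (Real.continuous_sqrt.tendsto 0).comp h1
    rw [Real.sqrt_zero] at h2
    refine h2.congr fun n => ?_
    simp [t, norm_inner_symm y]
  refine ⟨Submodule.Quotient.mk ⟨t, ht⟩, 0, fun h0 => ?_⟩
  have h1 : Tendsto t atTop (𝓝 0) := (Submodule.Quotient.mk_eq_zero _).1 h0
  have h2 := h1.norm
  have h3 : (fun n => ‖t n‖) = fun _ => (1 : ℝ) := funext he.1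
  rw [h3, norm_zero] at h2
  exact one_ne_zero (tendsto_nhds_unique tendsto_const_nhds h2)

/-- An operator on an infinite-dimensional Hilbert space has a point in its left essential
spectrum. -/
theorem exists_essential_approximate_eigenvalue [CompleteSpace H] (hH : ¬ FiniteDimensional ℂ H)
    (T : H →L[ℂ] H) :
    ∃ z : ℂ, ∀ ε > 0, ∀ F : Submodule ℂ H, FiniteDimensional ℂ F →
      ∃ x ∈ Fᗮ, ‖x‖ = 1 ∧ ‖(T - z • ContinuousLinearMap.id ℂ H) x‖ ≤ ε := by
  have := nontrivial_weaklyNullQuotient hH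
  obtain ⟨z, hz⟩ := ContinuousLinearMap.exists_approximate_eigenvalue
    (E := weaklyNullSequences H ⧸ nullInWeaklyNull H) (weaklyNullQuotientMap T)
  refine ⟨z, fun ε hε F hF => ?_⟩
  set S := T - z • ContinuousLinearMap.id ℂ H with hS
  -- Four errors of `ε / 8 * r` will add up: the quotient estimate, the choice of representative,
  -- the tail, and the projection onto `F`. The corrected vector keeps norm above `r / 2`.
  obtain ⟨q, hq⟩ := hz (ε / 8) (by positivity)
  obtain ⟨x, rfl⟩ := Submodule.Quotient.mk_surjective _ q
  set r := ‖(Submodule.Quotient.mk x : weaklyNullSequences H ⧸ nullInWeaklyNull H)‖ with hr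
  have hr0 : 0 < r := by
    by_contra! h
    have := norm_nonneg (weaklyNullQuotientMap T (Submodule.Quotient.mk x) -
      z • Submodule.Quotient.mk x)
    nlinarith
  have hSx : weaklyNullQuotientMap T (Submodule.Quotient.mk x) - z • Submodule.Quotient.mk x =
      Submodule.Quotient.mk (weaklyNullMap S x) := rfl
  rw [hSx] at hq
  obtain ⟨m, hm, hmn⟩ := Submodule.Quotient.norm_mk_lt
    (Submodule.Quotient.mk (weaklyNullMap S x) : weaklyNullSequences H ⧸ nullInWeaklyNull H)
    (ε := ε / 8 * r) (by positivity)
  have hd : Tendsto ((m - weaklyNullMap S x : weaklyNullSequences H) : ℕ →ᵇ H) atTop (𝓝 0) :=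
    (Submodule.Quotient.eq _).1 hm
  have hSn : ∀ᶠ n in atTop, ‖S ((x : ℕ →ᵇ H) n)‖ < 3 * (ε / 8) * r := by
    filter_upwards [(tendsto_zero_iff_norm_tendsto_zero.1 hd).eventually_lt_const
      (show 0 < ε / 8 * r by positivity)] with n hn
    have h1 : ‖(m : ℕ →ᵇ H) n‖ ≤ ‖m‖ := (m : ℕ →ᵇ H).norm_coe_le_norm n
    have h2 : S ((x : ℕ →ᵇ H) n) = (m : ℕ →ᵇ H) n -
      ((m - weaklyNullMap S x : weaklyNullSequences H) : ℕ →ᵇ H) n := by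
      simp [weaklyNullMap_apply]
    have h3 := norm_sub_le ((m : ℕ →ᵇ H) n)
      (((m - weaklyNullMap S x : weaklyNullSequences H) : ℕ →ᵇ H) n)
    rw [← h2] at h3
    linarith
  have hfreq : ∃ᶠ n in atTop, 3 / 4 * r < ‖(x : ℕ →ᵇ H) n‖ := by
    intro h
    have := norm_mk_le_of_eventually (x := x) (r := 3 / 4 * r) (by positivity)
      (h.mono fun n hn => not_lt.1 hn)
    linarith
  -- Weak convergence becomes norm convergence under a finite-rank projection.
  have hP : Tendsto (fun n => F.starProjection ((x : ℕ →ᵇ H) n)) atTop (𝓝 0) := by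
    let b := stdOrthonormalBasis ℂ F
    have h1 : ∀ v, F.starProjection v = ∑ i, inner ℂ (b i : H) v • (b i : H) := fun v => by
      rw [Submodule.starProjection_apply, b.orthogonalProjectionOnto_apply_eq_sum]
      simp
    simp only [h1]
    rw [← Finset.sum_const_zero (s := Finset.univ) (ι := Fin (Module.finrank ℂ F))]
    refine tendsto_finsetSum _ fun i _ => ?_
    simpa using (mem_weaklyNullSequences.1 x.2 (b i : H)).smul_const (b i : H)
  have hP1 := (tendsto_zero_iff_norm_tendsto_zero.1 hP).eventually_lt_const
    (show 0 < 1 / 4 * r by positivity)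
  have hSP := (S.continuous.tendsto 0).comp hP
  rw [map_zero] at hSP
  have hP2 := (tendsto_zero_iff_norm_tendsto_zero.1 hSP).eventually_lt_const
    (show 0 < ε / 8 * r by positivity)
  obtain ⟨n, hn, h1, h2, h3⟩ := (hfreq.and_eventually (hSn.and (hP1.and hP2))).exists
  set v := (x : ℕ →ᵇ H) n
  simp only [Function.comp_apply] at h3
  set y := v - F.starProjection v with hy
  have hyF : y ∈ Fᗮ := Submodule.sub_starProjection_mem_orthogonal v
  have hyn : r / 2 < ‖y‖ := by
    have := norm_sub_norm_le v (F.starProjection v)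
    linarith
  have hSy : ‖S y‖ ≤ ε * (r / 2) := by
    rw [hy, map_sub]
    have := norm_sub_le (S v) (S (F.starProjection v))
    linarith
  have hy0 : 0 < ‖y‖ := by linarith
  refine ⟨((‖y‖⁻¹ : ℝ) : ℂ) • y, Submodule.smul_mem _ _ hyF, ?_, ?_⟩
  · rw [norm_smul]; simp [hy0.ne']
  · rw [map_smul, norm_smul]
    simp only [Complex.ofReal_inv, norm_inv, Complex.norm_real, norm_norm]
    rw [inv_mul_le_iff₀ hy0]
    nlinarith

/-! ### Perturbation to a non-surjective right inverse -/

theorem Orthonormal.countable_of_separableSpace [TopologicalSpace.SeparableSpace H] {ι : Type*}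
    {v : ι → H} (hv : Orthonormal ℂ v) : Countable ι := by
  rw [← Set.countable_univ_iff]
  refine Set.PairwiseDisjoint.countable_of_isOpen (s := fun i => Metric.ball (v i) (1 / 2)) ?_
    (fun _ _ => Metric.isOpen_ball) fun i _ => ⟨v i, Metric.mem_ball_self (by norm_num)⟩
  intro i _ j _ hij
  refine Metric.ball_disjoint_ball ?_
  rw [dist_eq_norm]
  have h := norm_sub_sq (𝕜 := ℂ) (v i) (v j)
  rw [hv.1 i, hv.1 j, hv.2 hij] at h
  norm_num at h
  nlinarith [norm_nonneg (v i - v j)]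

/-- An orthonormal sequence along which `S` decreases rapidly spans a copy of the whole space on
which `S` is small. -/
theorem exists_linearIsometry_norm_comp_le [CompleteSpace H] [TopologicalSpace.SeparableSpace H]
    (S : H →L[ℂ] H) {e : ℕ → H} (he : Orthonormal ℂ e) {δ : ℝ} (hδ : 0 < δ)
    (hS : ∀ n, ‖S (e n)‖ ≤ δ * (1 / 2) ^ n) :
    ∃ J : H →ₗᵢ[ℂ] H, ¬ Function.Surjective J ∧ ‖S ∘L J.toContinuousLinearMap‖ ≤ 2 * δ := by
  obtain ⟨w, b, hb⟩ := exists_hilbertBasis ℂ H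
  have := b.orthonormal.countable_of_separableSpace
  obtain ⟨g, hg⟩ := exists_injective_nat w
  -- The shift by one keeps `e 0` orthogonal to the range of `J`.
  have hgs : Function.Injective fun i => g i + 1 := (add_left_injective 1).comp hg
  have he' := (he.comp _ hgs).orthogonalFamily
  let J : H →ₗᵢ[ℂ] H := he'.linearIsometry.comp b.repr.toLinearIsometry
  have hJ : ∀ x, HasSum (fun i => b.repr x i • e (g i + 1)) (J x) := fun x => by
    simpa [J] using he'.hasSum_linearIsometry (b.repr x)
  refine ⟨J, fun hsurj => ?_, ContinuousLinearMap.opNorm_le_bound _ (by positivity) fun x => ?_⟩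
  · obtain ⟨x, hx⟩ := hsurj (e 0)
    have h1 := (hJ x).mapL (innerSL ℂ (e 0))
    have h2 : ∀ i, inner ℂ (e 0) (e (g i + 1)) = 0 := fun i => he.2 (by simp)
    simp only [map_smul, innerSL_apply_apply, h2, smul_zero, hx] at h1
    have h3 := h1.unique hasSum_zero
    rw [inner_self_eq_zero] at h3
    exact he.ne_zero 0 h3
  · have hgeo : Summable fun n : ℕ => δ * (1 / 2 : ℝ) ^ n := summable_geometric_two.mul_left δ
    have hsum := ((hgeo.comp_injective hgs).mul_right ‖x‖).hasSum
    have h1 := (hJ x).mapL S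
    have h2 := tsum_of_norm_bounded (f := fun i => S (b.repr x i • e (g i + 1))) hsum fun i => by
      rw [map_smul, norm_smul, mul_comm]
      have : ‖b.repr x i‖ ≤ ‖x‖ := by
        simpa using lp.norm_apply_le_norm (p := 2) two_ne_zero (b.repr x) i
      exact mul_le_mul (hS _) this (norm_nonneg _) (mul_nonneg hδ.le (by positivity))
    rw [h1.tsum_eq, tsum_mul_right] at h2
    refine h2.trans ?_
    gcongr
    refine (tsum_comp_le_tsum_of_inj hgeo (fun n => by positivity) hgs).trans ?_
    rw [tsum_mul_left, tsum_geometric_two, mul_comm]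

/-- Operators with a non-surjective right inverse, after a scalar shift, form an open set of
operators with nonempty point spectrum. -/
theorem mem_interior_pointSpectrum_nonempty [CompleteSpace H] {T R : H →L[ℂ] H} {z : ℂ}
    (hTR : (T - z • ContinuousLinearMap.id ℂ H) * R = 1) (hR : ¬ Function.Surjective R) :
    T ∈ interior {T : H →L[ℂ] H | (pointSpectrum T).Nonempty} := by
  refine mem_interior.2 ⟨(fun C : H →L[ℂ] H => (C - z • ContinuousLinearMap.id ℂ H) * R) ⁻¹'
    {u | IsUnit u}, fun C hC => ⟨z, fun hker => hR fun x => ?_⟩,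
    Units.isOpen.preimage (by fun_prop), ?_⟩
  · obtain ⟨u, hu⟩ := hC
    set D := C - z • ContinuousLinearMap.id ℂ H
    refine ⟨((u⁻¹ : (H →L[ℂ] H)ˣ) : H →L[ℂ] H) (D x), LinearMap.ker_eq_bot.1 hker ?_⟩
    change (D * R * ((u⁻¹ : (H →L[ℂ] H)ˣ) : H →L[ℂ] H)) (D x) = D x
    rw [show D * R = u from hu.symm, Units.mul_inv, one_apply_eq_self]
  · simp [hTR]

theorem dense_interior_pointSpectrum_nonempty [CompleteSpace H]
    [TopologicalSpace.SeparableSpace H] (hH : ¬ FiniteDimensional ℂ H) :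
    Dense (interior {T : H →L[ℂ] H | (pointSpectrum T).Nonempty}) := by
  refine fun T => Metric.mem_closure_iff.2 fun ε hε => ?_
  obtain ⟨z, hz⟩ := exists_essential_approximate_eigenvalue hH T
  set S := T - z • ContinuousLinearMap.id ℂ H with hS
  obtain ⟨δ, hδ, hδε⟩ : ∃ δ : ℝ, 0 < δ ∧ 3 * δ < ε := ⟨ε / 4, by positivity, by linarith⟩
  obtain ⟨e, he, hSe⟩ := exists_orthonormal_seq_of_forall_finiteDimensional S hz hδ
  obtain ⟨J, hJ, hSJ⟩ := exists_linearIsometry_norm_comp_le S he hδ hSe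
  set j : H →L[ℂ] H := J.toContinuousLinearMap with hj
  have hjj : j.adjoint * j = 1 := J.adjoint_comp_self
  have hjn : ‖j.adjoint‖ ≤ 1 := by
    rw [LinearIsometryEquiv.norm_map]
    exact J.norm_toContinuousLinearMap_le
  have hδ' : (δ : ℂ) ≠ 0 := by exact_mod_cast hδ.ne'
  -- Subtracting `z` leaves `S (1 - j j*) + δ j*`, whose product with `δ⁻¹ j` is 1 because `j* j =
  -- 1`. The change costs at most `2 δ + δ`.
  refine ⟨T - S * j * j.adjoint + (δ : ℂ) • j.adjoint,
    mem_interior_pointSpectrum_nonempty (z := z) (R := (δ : ℂ)⁻¹ • j) ?_ fun h => hJ fun y => ?_, ?_⟩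
  · have h1 : T - S * j * j.adjoint + (δ : ℂ) • j.adjoint - z • ContinuousLinearMap.id ℂ H =
        S - S * j * j.adjoint + (δ : ℂ) • j.adjoint := by rw [hS]; abel
    rw [h1, mul_smul_comm, add_mul, sub_mul, mul_assoc (S * j), hjj, mul_one, sub_self, zero_add,
      smul_mul_assoc, hjj, smul_smul, inv_mul_cancel₀ hδ', one_smul]
  · obtain ⟨x, hx⟩ := h y
    exact ⟨(δ : ℂ)⁻¹ • x, by rw [map_smul]; exact hx⟩
  · rw [dist_eq_norm]
    have h1 : T - (T - S * j * j.adjoint + (δ : ℂ) • j.adjoint) =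
        S * j * j.adjoint - (δ : ℂ) • j.adjoint := by abel
    rw [h1]
    refine (norm_sub_le _ _).trans_lt ?_
    have h2 : ‖S * j * j.adjoint‖ ≤ 2 * δ * 1 :=
      (norm_mul_le _ _).trans (mul_le_mul hSJ hjn (norm_nonneg _) (by positivity))
    have h3 : ‖(δ : ℂ) • j.adjoint‖ ≤ δ := by
      rw [norm_smul, Complex.norm_real, Real.norm_of_nonneg hδ.le]
      exact mul_le_of_le_one_right hδ.le hjn
    linarith

theorem pointSpectrum_nonempty_of_finiteDimensional [FiniteDimensional ℂ H] [Nontrivial H]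
    (T : H →L[ℂ] H) : (pointSpectrum T).Nonempty := by
  obtain ⟨z, hz⟩ := Module.End.exists_eigenvalue T.toLinearMap
  obtain ⟨x, hx⟩ := hz.exists_hasEigenvector
  refine ⟨z, fun h => hx.2 (LinearMap.ker_eq_bot'.1 h x ?_)⟩
  have : T x = z • x := hx.apply_eq_smul
  simp [this]

end Hilbert

theorem theorem1 {H : Type*} [NormedAddCommGroup H] [InnerProductSpace ℂ H] [CompleteSpace H]
    [TopologicalSpace.SeparableSpace H] [Nontrivial H] :
    IsNowhereDense {T : H →L[ℂ] H | pointSpectrum T = ∅} ∧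
      {T : H →L[ℂ] H | (pointSpectrum T).Nonempty} ∈ residual (H →L[ℂ] H) := by
  have hd : Dense (interior {T : H →L[ℂ] H | (pointSpectrum T).Nonempty}) := by
    by_cases hH : FiniteDimensional ℂ H
    · simp [pointSpectrum_nonempty_of_finiteDimensional]
    · exact dense_interior_pointSpectrum_nonempty hH
  refine ⟨?_, mem_of_superset (residual_of_dense_open isOpen_interior hd) interior_subset⟩
  have hc : {T : H →L[ℂ] H | pointSpectrum T = ∅} =
      {T : H →L[ℂ] H | (pointSpectrum T).Nonempty}ᶜ := by
    ext T; simp [Set.not_nonempty_iff_eq_empty]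
  rw [IsNowhereDense, hc, closure_compl, interior_compl, hd.closure_eq, Set.compl_univ]
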